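/- **Setting.** A *timetable* has finitely many stations, each with a minimum transfer time $\mathrm{transfer}(S)\in\mathbb N$, and finitely many elementary connections $c=(Z_1,Z_2,S_1,S_2,t_d,t_a)$: a train leaves $S_1$ after stop event $Z_1$ at time of day $t_d$, and its next stop is $Z_2$ at $S_2$ at time of day $t_a$ ($t_d,t_a\in\{0,\dots,1439\}$). Each $c$ has a set of days (out of $N$ traffic days) on which it departs; $\mathrm{length}(c)=(t_a-t_d)\bmod 1440$. At most one elementary connection departs from, and at most one arrives with, a given stop event of a station. A *consistent connection* from $A$ to $B$ is a nonempty sequence of elementary connections $c_i$ with absolute departure times $\mathrm{dep}_i$ such that $S_1(c_1)=A$, $S_2(c_k)=B$, $c_i$ is valid on day $\lfloor \mathrm{dep}_i/1440\rfloor$, $\mathrm{dep}_i\equiv t_d(c_i) \pmod{1440}$, $\mathrm{arr}_i=\mathrm{dep}_i+\mathrm{length}(c_i)$, $S_2(c_i)=S_1(c_{i+1})$, and $\mathrm{dep}_{i+1}-\mathrm{arr}_i\ge 0$ if $Z_1(c_{i+1})=Z_2(c_i)$, $\ge \mathrm{transfer}(S_2(c_i))$ otherwise. The *earliest arrival problem*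 (EAP) for a time query $(A,B,t_0)$ asks for the minimal arrival time of a consistent connection from $A$ to $B$ departing not before $t_0$ ($\bot$ if there is none; $t_0$ if $A=B$). **Station graph.** A station graph has one node per station and to each ordered pair of stations (edge, possibly a loop) a set of connections, each stored as $(Z_1,Z_2,\mathrm{dep},\mathrm{arr})$; the edge exists if the set is nonempty. Initially an edge $(u,w)$ holds all rides of a single elementary connection from $u$ to $w$. Two connections are *linked* if they are consistent one after the other. Let $\mathrm{parr}(Q)$ be the previous arrival time of the train of $Z_1(Q)$ at $S_1(Q)$ and $\mathrm{ndep}(Q)$ the next departure time of the train of $Z_2(Q)$ at $S_2(Q)$ (if they exist); the departure of $Q$ is *critical* if $\mathrm{dep}(Q)-\mathrm{parr}(Q)<\mathrm{transfer}(S_1(Q))$, its arrival if $\mathrm{ndep}(Q)-\mathrm{arr}(Q)<\mathrm{transfer}(S_2(Q))$. $P$ *dominates* $Q$ if they have the same end points; $\mathrm{dep}(Q)\le\mathrm{dep}(P)$, $\mathrm{arr}(P)\le\mathrm{arr}(Q)$; $Z_1(Q)=Z_1(P)$ or the departure of $Q$ is not critical or $\mathrm{dep}(P)-\mathrm{parr}(Q)\ge\mathrm{transfer}(S_1(P))$;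 and $Z_2(Q)=Z_2(P)$ or the arrival of $Q$ is not critical or $\mathrm{ndep}(Q)-\mathrm{arr}(P)\ge\mathrm{transfer}(S_2(P))$. **Contraction.** Contracting $v$ removes $v$ with its edges. For remaining $u,w$ (possibly $u=w$, giving a loop) the shortcut $(u,w)$ represents all connections obtained by linking along $\langle u,v,w\rangle$ and, if $v$ has a loop, along $\langle u,v,v,w\rangle,\langle u,v,v,v,w\rangle,\dots$. The new edge $(u,w)$ holds connections of the old edge $(u,w)$ and of the shortcut (parallel edges are merged) such that every connection of the old edge is dominated by one of the new edge, and every connection of the shortcut is dominated by one of the new edge or by a witness, i.e. a connection along a path from $u$ to $w$ in the graph before the contraction that avoids $v$. A *station graph CH* results from contracting all stations in any order, with any such choices; its edge $(u,w)$ is the edge $(u,w)$ just before the first of $u,w$ is contracted. **Time query $(A,B,t_0)$ in the CH.** First, a backward breadth-first search from $B$ over the edges $(S,T)$ with $T$ contracted before $S$ marks all such edges into visited nodes. Then a label correcting forward search from $A$ keeps at each station a set of arrival connections $(\mathrm{arr},Z_2)$. It starts with $(t_0,\forall)$ at $A$, where the special stop event $\forall$ allows boarding every train departing at or after $t_0$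 and $A$ is in the priority queue with key $t_0$. Repeatedly it removes a station $S$ with minimal key $t$ and returns $t$ if $S=B$. Otherwise it relaxes all edges $(S,T)$ that are loops, lead to a $T$ contracted after $S$, or are marked: the arrival connections at $S$ are linked with the edge and merged with those at $T$ to a dominant set (one representative per class of equivalent ones, an old one if available; domination of arrival connections compares only the arrival side, and $\forall$ dominates all later arrivals and is dominated by no other); if the set at $T$ changes, $T$ is put into the queue with its minimal arrival time as key. If the queue is empty, $\bot$ is returned. **Theorem.** For every timetable, every station graph CH of it and every time query $(A,B,t_0)$, every execution of the time query in the CH terminates and returns the solution of the EAP. -/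

import Mathlib

namespace StationGraph

/-! ### Timetables and consistent connections -/

/-- An elementary connection `(Z₁, Z₂, S₁, S₂, t_d, t_a)`: a train leaves station `S1` at time `td`
after its stop `Z1`, and its immediately next stop is `Z2` at station `S2`, at time `ta`. Labels of
stop events are local to a station (they are only ever compared at one and the same station). -/
structure ElemConn (B Z : Type*) where
  Z1 : Z
  Z2 : Z
  S1 : B
  S2 : B
  td : ℤ
  ta : ℤ

/-- The smallest nonnegative integer congruent to `t' - t` modulo `1440`. -/
def cycleDiff (t t' : ℤ) : ℤ := (t' - t) % 1440

/-- `length(c)`. -/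
def ElemConn.length {B Z : Type*} (c : ElemConn B Z) : ℤ := cycleDiff c.td c.ta

/-- A timetable. Times of day are in minutes after midnight, `transfer S` is the minimum transfer
time of the station `S`, `days c` is the set of those of the `N` traffic days on which `c` departs
(for trains that operate daily, all of them). A stop event is a single stop of a single train, so at
most one elementary connection departs from it and at most one arrives with it. -/
structure Timetable (B Z : Type*) where
  conns : Finset (ElemConn B Z)
  transfer : B → ℕ
  N : ℕ
  days : ElemConn B Z → Finset ℤ
  td_mem : ∀ c ∈ conns, 0 ≤ c.td ∧ c.td ≤ 1439
  ta_mem : ∀ c ∈ conns, 0 ≤ c.ta ∧ c.ta ≤ 1439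
  days_mem : ∀ c ∈ conns, ∀ d ∈ days c, 0 ≤ d ∧ d < N
  dep_unique : ∀ c ∈ conns, ∀ c' ∈ conns, c.S1 = c'.S1 → c.Z1 = c'.Z1 → c = c'
  arr_unique : ∀ c ∈ conns, ∀ c' ∈ conns, c.S2 = c'.S2 → c.Z2 = c'.Z2 → c = c'

variable {B Z : Type*}

namespace Timetable

open Classical in
/-- The time needed at station `S` between arriving with stop event `z` and departing with stop
event `z'`: nothing for staying on the train, the minimum transfer time otherwise. -/
noncomputable def minWait (T : Timetable B Z) (S : B) (z z' : Z) : ℤ :=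
  if z' = z then 0 else (T.transfer S : ℤ)

/-- `c` can be ridden with departure at the absolute time `d` (in minutes from the beginning of the
first day): it is valid on the day of `d`, and departs at that time of the day. -/
def Runs (T : Timetable B Z) (x : ElemConn B Z × ℤ) : Prop :=
  x.1 ∈ T.conns ∧ x.2 / 1440 ∈ T.days x.1 ∧ x.2 ≡ x.1.td [ZMOD 1440]

/-- Riding `x.1` from time `x.2` may be followed by riding `y.1` from time `y.2`. -/
def Follows (T : Timetable B Z) (x y : ElemConn B Z × ℤ) : Prop :=
  x.1.S2 = y.1.S1 ∧ T.minWait x.1.S2 x.1.Z2 y.1.Z1 ≤ y.2 - (x.1.length + x.2)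

/-- `P = ((c₁, dep₁), …, (c_k, dep_k))` with `arr_i = length(c_i) + dep_i` is a consistent connection
from station `a` to station `b` with departure time `d` and arrival time `t`. -/
def IsConsistent (T : Timetable B Z) (P : List (ElemConn B Z × ℤ)) (a b : B) (d t : ℤ) : Prop :=
  (∀ x ∈ P, T.Runs x) ∧ P.IsChain T.Follows ∧
    (∃ x, P.head? = some x ∧ x.1.S1 = a ∧ x.2 = d) ∧
    (∃ x, P.getLast? = some x ∧ x.1.S2 = b ∧ x.1.length + x.2 = t)

/-- With the time query `(a, b, t₀)` one can be at `b` at time `t`: some valid consistent connection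
(departing not before `t₀`) arrives at `b` at time `t`, or `b = a` and `t = t₀`. -/
def Reaches (T : Timetable B Z) (a b : B) (t₀ t : ℤ) : Prop :=
  (b = a ∧ t = t₀) ∨ ∃ P d, T.IsConsistent P a b d t ∧ t₀ ≤ d

/-- The answer `r` solves the earliest arrival problem for the time query `(a, b, t₀)`: it is the
minimal arrival time, or `none` (that is, `⊥`) if `b` cannot be reached. -/
def SolvesEAP (T : Timetable B Z) (a b : B) (t₀ : ℤ) : Option ℤ → Prop
  | some t => IsLeast {t' | T.Reaches a b t₀ t'} t
  | none => ∀ t, ¬ T.Reaches a b t₀ t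

end Timetable

/-! ### The station graph, linking and domination -/

/-- A connection as it is stored with an edge: first and last stop event, departure and arrival
station, departure and arrival time (including days). -/
structure Conn (B Z : Type*) where
  Z1 : Z
  Z2 : Z
  S1 : B
  S2 : B
  dep : ℤ
  arr : ℤ

/-- A station graph: one node per station, and for each ordered pair of stations one set of
connections. There is an edge `(u, w)` iff the set for `u`, `w` is nonempty. -/
abbrev Graph (B Z : Type*) := B → B → Set (Conn B Z)

/-- The connection obtained by linking `P` and `Q`. -/
def Conn.link (P Q : Conn B Z) : Conn B Z := ⟨P.Z1, Q.Z2, P.S1, Q.S2, P.dep, Q.arr⟩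

namespace Timetable

/-- The station graph of the timetable: the edge `(u, w)` holds all rides of a single elementary
connection from `u` to `w`. -/
def stationGraph (T : Timetable B Z) : Graph B Z := fun u w =>
  {P | ∃ c d, T.Runs (c, d) ∧ c.S1 = u ∧ c.S2 = w ∧ P = ⟨c.Z1, c.Z2, u, w, d, c.length + d⟩}

/-- `P` followed by `Q` is consistent. -/
def CanLink (T : Timetable B Z) (P Q : Conn B Z) : Prop :=
  P.S2 = Q.S1 ∧ T.minWait P.S2 P.Z2 Q.Z1 ≤ Q.dep - P.arr

/-- `parr = t`, for a departure at time `d` from the station `S` with the stop event `z`: the train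
of `z` has arrived there at time `t`. There is no such `t` if the train begins there. -/
def IsPrevArr (T : Timetable B Z) (S : B) (z : Z) (d t : ℤ) : Prop :=
  ∃ c ∈ T.conns, c.S2 = S ∧ c.Z2 = z ∧ t = d - cycleDiff c.ta d

/-- `ndep = t`, for an arrival at time `d` at the station `S` with the stop event `z`: the train of
`z` departs there at time `t`. There is no such `t` if the train ends there. -/
def IsNextDep (T : Timetable B Z) (S : B) (z : Z) (d t : ℤ) : Prop :=
  ∃ c ∈ T.conns, c.S1 = S ∧ c.Z1 = z ∧ t = d + cycleDiff d c.td

/-- A departure is critical if the residence time is less than the transfer time. -/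
def CriticalDep (T : Timetable B Z) (S : B) (z : Z) (d : ℤ) : Prop :=
  ∃ t, T.IsPrevArr S z d t ∧ d - t < T.transfer S

/-- An arrival is critical if the residence time is less than the transfer time. -/
def CriticalArr (T : Timetable B Z) (S : B) (z : Z) (d : ℤ) : Prop :=
  ∃ t, T.IsNextDep S z d t ∧ t - d < T.transfer S

/-- The connection `P` dominates the connection `Q`. -/
def Dominates (T : Timetable B Z) (P Q : Conn B Z) : Prop :=
  (P.S1 = Q.S1 ∧ P.S2 = Q.S2) ∧
  (Q.dep ≤ P.dep ∧ P.arr ≤ Q.arr) ∧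
  (Q.Z1 = P.Z1 ∨ ¬ T.CriticalDep Q.S1 Q.Z1 Q.dep ∨
    ∃ t, T.IsPrevArr Q.S1 Q.Z1 Q.dep t ∧ T.transfer P.S1 ≤ P.dep - t) ∧
  (Q.Z2 = P.Z2 ∨ ¬ T.CriticalArr Q.S2 Q.Z2 Q.arr ∨
    ∃ t, T.IsNextDep Q.S2 Q.Z2 Q.arr t ∧ T.transfer P.S2 ≤ t - P.arr)

end Timetable

/-! ### Contraction -/

/-- `PathConn T G v u w P`: the connection `P` is obtained by linking connections along a path from
`u` to `w` in `G` that avoids the node `v`. -/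
inductive PathConn (T : Timetable B Z) (G : Graph B Z) (v u : B) : B → Conn B Z → Prop
  | edge {w : B} {P : Conn B Z} : u ≠ v → w ≠ v → P ∈ G u w → PathConn T G v u w P
  | snoc {x w : B} {P Q : Conn B Z} : PathConn T G v u x P → w ≠ v → Q ∈ G x w → T.CanLink P Q →
      PathConn T G v u w (P.link Q)

/-- The connections along the edge `(u, v)` followed by any number of traversals of the loop at `v`,
that is, along the paths `⟨u, v⟩`, `⟨u, v, v⟩`, `⟨u, v, v, v⟩`, … -/
inductive LoopConn (T : Timetable B Z) (G : Graph B Z) (v u : B) : Conn B Z → Prop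
  | edge {P : Conn B Z} : P ∈ G u v → LoopConn T G v u P
  | loop {P Q : Conn B Z} : LoopConn T G v u P → Q ∈ G v v → T.CanLink P Q →
      LoopConn T G v u (P.link Q)

/-- The connections that a shortcut `(u, w)` for the node `v` has to represent: those along
`⟨u, v, w⟩` and, if there is a loop at `v`, along `⟨u, v, v, w⟩`, `⟨u, v, v, v, w⟩`, … -/
def shortcut (T : Timetable B Z) (G : Graph B Z) (v u w : B) : Set (Conn B Z) :=
  {R | ∃ P Q, LoopConn T G v u P ∧ Q ∈ G v w ∧ T.CanLink P Q ∧ R = P.link Q}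

/-- `G'` is a result of contracting the node `v` in the graph `G`. The node `v` and its edges are
removed. A shortcut may be added between any two remaining stations `u`, `w`, a loop if `u = w`; it
is merged with an edge `(u, w)` that exists already, and dominated connections may be dropped in the
merge. A connection of a shortcut can only be left out if a witness dominates it, that is, a
connection along a path from `u` to `w` in `G` that avoids `v` (there is no obligation to find
witnesses). -/
structure Contracts (T : Timetable B Z) (v : B) (G G' : Graph B Z) : Prop where
  removed : ∀ u w, u = v ∨ w = v → G' u w = ∅
  sub : ∀ u w, u ≠ v → w ≠ v → G' u w ⊆ G u w ∪ shortcut T G v u w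
  merged : ∀ u w, u ≠ v → w ≠ v → ∀ Q ∈ G u w, ∃ P ∈ G' u w, T.Dominates P Q
  shortcuts : ∀ u w, u ≠ v → w ≠ v → ∀ Q ∈ shortcut T G v u w,
    (∃ P ∈ G' u w, T.Dominates P Q) ∨ (∃ P, PathConn T G v u w P ∧ T.Dominates P Q)

/-- A station graph contraction hierarchy: all (finitely many) stations are contracted one after the
other, in an arbitrary order. `graph i` is the remaining graph after `i` contractions. -/
structure Hierarchy (T : Timetable B Z) where
  n : ℕ
  order : Fin n ≃ B
  graph : ℕ → Graph B Z
  graph_zero : graph 0 = T.stationGraph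
  contracts : ∀ i : Fin n, Contracts T (order i) (graph i) (graph (i + 1))

namespace Hierarchy

variable {T : Timetable B Z}

/-- The position of a station in the contraction order. -/
def rank (H : Hierarchy T) (u : B) : ℕ := H.order.symm u

/-- The edges of the hierarchy: the edge `(u, w)` as it was when the first of its end points was
contracted (thus with all the shortcuts that were merged into it). -/
def edge (H : Hierarchy T) : Graph B Z := fun u w => H.graph (min (H.rank u) (H.rank w)) u w

end Hierarchy

/-! ### The hierarchical time query -/

/-- An arrival connection, stored with a station. The stop event is `none` for the special initial
stop event `∀`, from which every train that departs not earlier can be boarded. -/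
structure Arrival (Z : Type*) where
  arr : ℤ
  event : Option Z

namespace Timetable

/-- An arrival connection at the station `S` can be linked with `Q`. -/
def CanBoard (T : Timetable B Z) (S : B) (P : Arrival Z) (Q : Conn B Z) : Prop :=
  match P.event with
  | none => P.arr ≤ Q.dep
  | some z => T.minWait S z Q.Z1 ≤ Q.dep - P.arr

/-- Domination of arrival connections at the station `S`. The initial one allows boarding all
trains, hence it dominates all later ones, and is dominated by no others. -/
def DominatesArr (T : Timetable B Z) (S : B) (P Q : Arrival Z) : Prop :=
  P.arr ≤ Q.arr ∧
    match P.event, Q.event with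
    | none, _ => True
    | some _, none => False
    | some z, some z' => z' = z ∨ ¬ T.CriticalArr S z' Q.arr ∨
        ∃ t, T.IsNextDep S z' Q.arr t ∧ T.transfer S ≤ t - P.arr

/-- The link operation: the arrival connections `X` at the station `S`, linked with an edge that
starts in `S` and holds the connections `E`. -/
def linkArr (T : Timetable B Z) (S : B) (X : Set (Arrival Z)) (E : Set (Conn B Z)) :
    Set (Arrival Z) :=
  {R | ∃ P ∈ X, ∃ Q ∈ E, T.CanBoard S P Q ∧ R = ⟨Q.arr, some Q.Z2⟩}

/-- The minimum operation: `N` is a dominant set of the arrival connections at `S` that are in `old`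
or `new`. Of several equivalent ones only one is kept, from `old` if available. -/
structure IsMinimum (T : Timetable B Z) (S : B) (old new N : Set (Arrival Z)) : Prop where
  sub : N ⊆ old ∪ new
  dominating : ∀ Q ∈ old ∪ new, ∃ P ∈ N, T.DominatesArr S P Q
  dominant : ∀ P ∈ N, ∀ Q ∈ N, T.DominatesArr S P Q → P = Q
  prefer_old : ∀ Q ∈ N, Q ∉ old → ∀ P ∈ old, ¬ T.DominatesArr S P Q

end Timetable

/-- The configurations of the query algorithm. The backward search has a FIFO queue and the set of
visited nodes. The forward search has the nodes that the backward search has visited (`corridor`),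
the sets `ac` of arrival connections, and the priority queue `Q`, where `Q S` is the key of `S`, or
`none` if `S` is not in the queue. It is either at the head of its main loop (`forward`) or is
processing the edges from `S` to the nodes in `todo` (`relaxing`). -/
inductive Config (B Z : Type*)
  | backward (queue : List B) (visited : Set B)
  | forward (corridor : Set B) (ac : B → Set (Arrival Z)) (Q : B → Option ℤ)
  | relaxing (corridor : Set B) (S : B) (todo : Set B) (ac : B → Set (Arrival Z))
      (Q : B → Option ℤ)
  | done (result : Option ℤ)

namespace Hierarchy

variable {T : Timetable B Z}

/-- The edges that the forward search relaxes: those that do not lead downwards (in particular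
loops), and the downward edges in the corridor of the backward search. -/
def SearchEdge (H : Hierarchy T) (corridor : Set B) (S S' : B) : Prop :=
  (H.edge S S').Nonempty ∧ (H.rank S ≤ H.rank S' ∨ S' ∈ corridor)

open Classical in
/-- One step of the time query `(a, b, t₀)` in the hierarchy. First a breadth first search from `b`
visits backwards all edges that lead downwards. Then follows the label correcting forward search
from `a`. Ties between minimal keys, the order of the edges, and the choices in the minimum
operation are left open. -/
inductive Step (H : Hierarchy T) (a b : B) (t₀ : ℤ) : Config B Z → Config B Z → Prop
  | visit {S' : B} {queue new : List B} {visited : Set B} :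
      new.Nodup →
      (∀ S, S ∈ new ↔ S ∉ visited ∧ (H.edge S S').Nonempty ∧ H.rank S' < H.rank S) →
      Step H a b t₀ (.backward (S' :: queue) visited)
        (.backward (queue ++ new) (visited ∪ {S | S ∈ new}))
  | start {visited : Set B} :
      Step H a b t₀ (.backward [] visited)
        (.forward visited
          (Function.update (fun _ => ∅) a {⟨t₀, none⟩})
          (Function.update (fun _ => none) a (some t₀)))
  | found {corridor : Set B} {ac : B → Set (Arrival Z)} {Q : B → Option ℤ} {t : ℤ} :
      Q b = some t → (∀ S' t', Q S' = some t' → t ≤ t') →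
      Step H a b t₀ (.forward corridor ac Q) (.done (some t))
  | deleteMin {corridor : Set B} {ac : B → Set (Arrival Z)} {Q : B → Option ℤ} {S : B} {t : ℤ} :
      S ≠ b → Q S = some t → (∀ S' t', Q S' = some t' → t ≤ t') →
      Step H a b t₀ (.forward corridor ac Q)
        (.relaxing corridor S {S' | H.SearchEdge corridor S S'} ac (Function.update Q S none))
  | keep {corridor todo : Set B} {ac : B → Set (Arrival Z)} {Q : B → Option ℤ} {S S' : B} :
      S' ∈ todo →
      T.IsMinimum S' (ac S') (T.linkArr S (ac S) (H.edge S S')) (ac S') →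
      Step H a b t₀ (.relaxing corridor S todo ac Q) (.relaxing corridor S (todo \ {S'}) ac Q)
  | improve {corridor todo : Set B} {ac : B → Set (Arrival Z)} {Q : B → Option ℤ} {S S' : B}
      {N : Set (Arrival Z)} {k : ℤ} :
      S' ∈ todo →
      T.IsMinimum S' (ac S') (T.linkArr S (ac S) (H.edge S S')) N → N ≠ ac S' →
      IsLeast (Arrival.arr '' N) k →
      Step H a b t₀ (.relaxing corridor S todo ac Q)
        (.relaxing corridor S (todo \ {S'}) (Function.update ac S' N)
          (Function.update Q S' (some k)))
  | next {corridor : Set B} {ac : B → Set (Arrival Z)} {Q : B → Option ℤ} {S : B} :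
      Step H a b t₀ (.relaxing corridor S ∅ ac Q) (.forward corridor ac Q)
  | exhausted {corridor : Set B} {ac : B → Set (Arrival Z)} {Q : B → Option ℤ} :
      (∀ S, Q S = none) →
      Step H a b t₀ (.forward corridor ac Q) (.done none)

/-- The initial configuration of a time query with target `b`. -/
def initial (_H : Hierarchy T) (b : B) : Config B Z := .backward [b] {b}

end Hierarchy

end StationGraph

/-! Domination compares a connection with a single arrival and a single departure of a train, but it
yields interchangeability (`Dominates.replaces`): the dominating connection fits wherever the
dominated one is linked to composed rides. Indeed, a stop event determines the arriving and the
departing elementary connection, so whoever stays on the train for the departure of `Q` arrived no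
later than `parr(Q)`; dually for `ndep(Q)`. The relation `Replaces` is transitive and compatible
with linking, hence replacements can be chained along paths.

Contracting `v` preserves all paths between remaining stations up to replacement: passages through
`v` become shortcuts, and a witness consists of old edges, which have replacements themselves
(`Contracts.exists_replaces_aux`). Induction on the number of stations left turns any path into one
made of upward edges, loops, and edges whose heads lead downwards to the target
(`Hierarchy.exists_searchGraph_path`). The forward search relaxes all of these.

The invariant `SearchInv` says that all stored arrivals are real and that the search edges out of
stations outside the queue are accounted for. As rides take no negative time, a path that arrives
before the least key boards only at such stations, so its arrival is dominated by a stored one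
(`SearchInv.exists_dominatesArr`). Hence a returned key is optimal. The search terminates because
only finitely many arrivals exist and every change of a stored set strictly shrinks the set of
undominated ones. -/

namespace StationGraph

variable {B Z : Type*}

/-! ### Paths of linked connections -/

/-- `Path T G u w P`: the connection `P` is obtained by linking connections along a path from `u`
to `w` in `G`. -/
inductive Path (T : Timetable B Z) (G : Graph B Z) (u : B) : B → Conn B Z → Prop
  | edge {w : B} {P : Conn B Z} : P ∈ G u w → Path T G u w P
  | snoc {x w : B} {P Q : Conn B Z} : Path T G u x P → Q ∈ G x w → T.CanLink P Q →
      Path T G u w (P.link Q)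

namespace Path

variable {T : Timetable B Z} {G G' : Graph B Z} {u w x : B} {P Q : Conn B Z}

/-- `link` keeps only the outer ends, so it is associative by definition; this and later regroupings
of links rely on it. -/
theorem append (hP : Path T G u x P) (hQ : Path T G x w Q) (h : T.CanLink P Q) :
    Path T G u w (P.link Q) := by
  induction hQ with
  | edge hQ => exact hP.snoc hQ h
  | @snoc y w Q R _ hR hl ih => exact snoc (P := P.link Q) (Q := R) (ih h) hR hl

theorem mono (hG : ∀ u w, G u w ⊆ G' u w) (hP : Path T G u w P) : Path T G' u w P := by
  induction hP with
  | edge hP => exact edge (hG _ _ hP)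
  | snoc _ hQ hl ih => exact ih.snoc (hG _ _ hQ) hl

theorem bind (hG : ∀ u w, ∀ P ∈ G u w, Path T G' u w P) (hP : Path T G u w P) :
    Path T G' u w P := by
  induction hP with
  | edge hP => exact hG _ _ _ hP
  | snoc _ hQ hl ih => exact ih.append (hG _ _ _ hQ) hl

/-- Induction along a path from its first edge. -/
theorem head_induction {motive : B → Conn B Z → Prop}
    (edge : ∀ {u P}, P ∈ G u w → motive u P)
    (cons : ∀ {u x P Q}, P ∈ G u x → Path T G x w Q → T.CanLink P Q → motive x Q →
      motive u (P.link Q))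
    (hP : Path T G u w P) : motive u P := by
  have key : ∀ {x P}, Path T G u x P → ∀ {R}, Path T G x w R → motive x R → T.CanLink P R →
      motive u (P.link R) := by
    intro x P hP
    induction hP with
    | edge hP => exact fun hR hm hl => cons hP hR hl hm
    | @snoc y z P Q _ hQ hl ih =>
      intro R hR hm hl'
      exact ih (R := Q.link R) ((Path.edge hQ).append hR hl') (cons hQ hR hl' hm) hl
  cases hP with
  | edge hP => exact edge hP
  | snoc hP hQ hl => exact key hP (.edge hQ) (edge hQ) hl

end Path

theorem LoopConn.path {T : Timetable B Z} {G : Graph B Z} {v u : B} {P : Conn B Z}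
    (h : LoopConn T G v u P) : Path T G u v P := by
  induction h with
  | edge h => exact .edge h
  | loop _ hQ hl ih => exact ih.snoc hQ hl

/-! ### Composed rides, previous arrivals and next departures. -/

namespace Timetable

variable {T : Timetable B Z}

theorem minWait_nonneg (T : Timetable B Z) (S : B) (z z' : Z) : 0 ≤ T.minWait S z z' := by
  unfold minWait
  split_ifs <;> omega

theorem minWait_self (T : Timetable B Z) (S : B) (z : Z) : T.minWait S z z = 0 := by
  simp [minWait]

theorem minWait_of_ne {S : B} {z z' : Z} (h : z' ≠ z) : T.minWait S z z' = T.transfer S := by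
  simp [minWait, h]

theorem minWait_le (T : Timetable B Z) (S : B) (z z' : Z) : T.minWait S z z' ≤ T.transfer S := by
  unfold minWait
  split_ifs <;> omega

/-- A connection that is composed of rides of elementary connections. -/
def Real (T : Timetable B Z) (P : Conn B Z) : Prop := ∃ u w, Path T T.stationGraph u w P

variable {u w : B} {P Q R P' Q' : Conn B Z}

theorem path_head (h : Path T T.stationGraph u w P) :
    ∃ x, T.Runs x ∧ x.1.S1 = u ∧ x.1.Z1 = P.Z1 ∧ P.S1 = u ∧ P.dep = x.2 := by
  induction h with
  | edge h =>
    obtain ⟨c, d, hr, h1, h2, rfl⟩ := h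
    exact ⟨(c, d), hr, h1, rfl, rfl, rfl⟩
  | snoc _ _ _ ih => exact ih

theorem path_last (h : Path T T.stationGraph u w P) :
    ∃ x, T.Runs x ∧ x.1.S2 = w ∧ x.1.Z2 = P.Z2 ∧ P.S2 = w ∧ P.arr = x.1.length + x.2 := by
  cases h with
  | edge h =>
    obtain ⟨c, d, hr, h1, h2, rfl⟩ := h
    exact ⟨(c, d), hr, h2, rfl, rfl, rfl⟩
  | snoc _ h _ =>
    obtain ⟨c, d, hr, h1, h2, rfl⟩ := h
    exact ⟨(c, d), hr, h2, rfl, rfl, rfl⟩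

theorem path_dep_le_arr (h : Path T T.stationGraph u w P) : P.dep ≤ P.arr := by
  have edge_le : ∀ {u w P}, P ∈ T.stationGraph u w → P.dep ≤ P.arr := by
    rintro u w _ ⟨c, d, hr, h1, h2, rfl⟩
    simp only [ElemConn.length, cycleDiff]
    omega
  induction h with
  | edge h => exact edge_le h
  | @snoc x w P Q _ hQ hl ih =>
    have := edge_le hQ
    have := hl.2
    have := T.minWait_nonneg P.S2 P.Z2 Q.Z1
    simp only [Conn.link]
    omega

theorem Real.head (h : T.Real P) :
    ∃ c ∈ T.conns, c.S1 = P.S1 ∧ c.Z1 = P.Z1 ∧ P.dep % 1440 = c.td % 1440 := by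
  obtain ⟨u, w, h⟩ := h
  obtain ⟨x, hx, h1, h2, h3, h4⟩ := path_head h
  exact ⟨x.1, hx.1, h1.trans h3.symm, h2, h4 ▸ hx.2.2⟩

theorem Real.last (h : T.Real P) :
    ∃ c ∈ T.conns, c.S2 = P.S2 ∧ c.Z2 = P.Z2 ∧ P.arr % 1440 = c.ta % 1440 := by
  obtain ⟨u, w, h⟩ := h
  obtain ⟨x, hx, h1, h2, h3, h4⟩ := path_last h
  refine ⟨x.1, hx.1, h1.trans h3.symm, h2, ?_⟩
  have := hx.2.2
  simp only [Int.ModEq] at this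
  rw [h4]
  simp only [ElemConn.length, cycleDiff]
  omega

/-- `d - cycleDiff t d` is the last moment up to `d` with time of day `t`. The arrival `a` may lie
whole days before it, since `Follows` does not bound the stay on a train. -/
theorem cycleDiff_le_of_dep {a t d : ℤ} (h : a % 1440 = t % 1440) (had : a ≤ d) :
    cycleDiff t d ≤ d - a := by
  unfold cycleDiff
  omega

theorem cycleDiff_le_of_arr {a t d : ℤ} (h : d % 1440 = t % 1440) (had : a ≤ d) :
    cycleDiff a t ≤ d - a := by
  unfold cycleDiff
  omega

/-- The train of the stop event with which `R` arrives and `Q` departs has arrived no earlier than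
`R`. -/
theorem Real.le_prevArr (hR : T.Real R) {t d : ℤ} (h : T.IsPrevArr R.S2 R.Z2 d t)
    (hd : R.arr ≤ d) : R.arr ≤ t := by
  obtain ⟨c, hc, h1, h2, h3⟩ := hR.last
  obtain ⟨c', hc', h1', h2', rfl⟩ := h
  obtain rfl := T.arr_unique c hc c' hc' (h1.trans h1'.symm) (h2.trans h2'.symm)
  have := cycleDiff_le_of_dep h3 hd
  omega

/-- A departure also counts as uncritical when it has no previous arrival. A composed ride arriving
with the stop event rules this out. -/
theorem Real.exists_prevArr (hR : T.Real R) (d : ℤ) : ∃ t, T.IsPrevArr R.S2 R.Z2 d t := by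
  obtain ⟨c, hc, h1, h2, h3⟩ := hR.last
  exact ⟨_, c, hc, h1, h2, rfl⟩

theorem Real.nextDep_le (hR : T.Real R) {t d : ℤ} (h : T.IsNextDep R.S1 R.Z1 d t)
    (hd : d ≤ R.dep) : t ≤ R.dep := by
  obtain ⟨c, hc, h1, h2, h3⟩ := hR.head
  obtain ⟨c', hc', h1', h2', rfl⟩ := h
  obtain rfl := T.dep_unique c hc c' hc' (h1.trans h1'.symm) (h2.trans h2'.symm)
  have := cycleDiff_le_of_arr h3 hd
  omega

theorem Real.exists_nextDep (hR : T.Real R) (d : ℤ) : ∃ t, T.IsNextDep R.S1 R.Z1 d t := by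
  obtain ⟨c, hc, h1, h2, h3⟩ := hR.head
  exact ⟨_, c, hc, h1, h2, rfl⟩

theorem CanLink.arr_le_dep (h : T.CanLink P Q) : P.arr ≤ Q.dep := by
  have := h.2
  have := T.minWait_nonneg P.S2 P.Z2 Q.Z1
  omega

theorem Real.link (hP : T.Real P) (hQ : T.Real Q) (h : T.CanLink P Q) : T.Real (P.link Q) := by
  obtain ⟨u, x, hP⟩ := hP
  obtain ⟨y, w, hQ⟩ := hQ
  obtain ⟨_, -, -, -, h1, -⟩ := path_last hP
  obtain ⟨_, -, -, -, h2, -⟩ := path_head hQ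
  obtain rfl : x = y := h1.symm.trans (h.1.trans h2)
  exact ⟨u, w, hP.append hQ h⟩

/-! ### Domination as interchangeability -/

/-- `P` can replace `Q` in all connections. -/
structure Replaces (T : Timetable B Z) (P Q : Conn B Z) : Prop where
  dep : Q.dep ≤ P.dep
  arr : P.arr ≤ Q.arr
  left : ∀ R, T.Real R → T.CanLink R Q → T.CanLink R P
  right : ∀ R, T.Real R → T.CanLink Q R → T.CanLink P R

theorem Replaces.refl (T : Timetable B Z) (P : Conn B Z) : T.Replaces P P :=
  ⟨le_rfl, le_rfl, fun _ _ h => h, fun _ _ h => h⟩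

theorem Replaces.trans (h : T.Replaces P Q) (h' : T.Replaces Q R) : T.Replaces P R :=
  ⟨h'.dep.trans h.dep, h.arr.trans h'.arr, fun S hS hl => h.left S hS (h'.left S hS hl),
    fun S hS hl => h.right S hS (h'.right S hS hl)⟩

/-- `Q'` is exchanged first, next to `P'`, and then `P'`, next to `Q`. So only the old left part and
the new right part have to be real. -/
theorem Replaces.canLink (h : T.Replaces P P') (h' : T.Replaces Q Q') (hP' : T.Real P')
    (hQ : T.Real Q) (hl : T.CanLink P' Q') : T.CanLink P Q :=
  h.right Q hQ (h'.left P' hP' hl)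

theorem Replaces.link (h : T.Replaces P P') (h' : T.Replaces Q Q') :
    T.Replaces (P.link Q) (P'.link Q') :=
  ⟨h.dep, h'.arr, h.left, h'.right⟩

/-- If a transfer takes place, the transfer time is already granted and the times of `P` are no
worse. If one stays on the train of `Q`, then either `P` has the same stop event, or the bound by
`parr` or `ndep` leaves the full transfer time. -/
theorem Dominates.replaces (h : T.Dominates P Q) : T.Replaces P Q := by
  obtain ⟨⟨hS1, hS2⟩, ⟨hd, ha⟩, hdep, harr⟩ := h
  refine ⟨hd, ha, fun R hR hl => ⟨hl.1.trans hS1.symm, ?_⟩, fun R hR hl => ⟨hS2.trans hl.1, ?_⟩⟩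
  · have h1 := hl.1
    have h2 := hl.2
    have hle := hl.arr_le_dep
    have hw := T.minWait_le R.S2 R.Z2 P.Z1
    by_cases hz : Q.Z1 = R.Z2
    · rcases hdep with h | h | ⟨t, ht, h⟩
      · rw [← h]
        omega
      · obtain ⟨t, ht⟩ := hR.exists_prevArr Q.dep
        have h3 := hR.le_prevArr ht hle
        rw [h1, ← hz] at ht
        have h4 : ¬ Q.dep - t < T.transfer Q.S1 := fun h4 => h ⟨t, ht, h4⟩
        rw [← h1] at h4
        omega
      · rw [← h1, hz] at ht
        have h3 := hR.le_prevArr ht hle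
        rw [hS1, ← h1] at h
        omega
    · rw [minWait_of_ne hz] at h2
      omega
  · have h1 := hl.1
    have h2 := hl.2
    have hle := hl.arr_le_dep
    have hw := T.minWait_le P.S2 P.Z2 R.Z1
    by_cases hz : R.Z1 = Q.Z2
    · rcases harr with h | h | ⟨t, ht, h⟩
      · rw [← h, hS2]
        omega
      · obtain ⟨t, ht⟩ := hR.exists_nextDep Q.arr
        have h3 := hR.nextDep_le ht hle
        rw [← h1, hz] at ht
        have h4 : ¬ t - Q.arr < T.transfer Q.S2 := fun h4 => h ⟨t, ht, h4⟩
        rw [← hS2] at h4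
        omega
      · rw [h1, ← hz] at ht
        have h3 := hR.nextDep_le ht hle
        omega
    · rw [minWait_of_ne hz, ← hS2] at h2
      omega

end Timetable

/-! ### Contraction -/

/-- All connections of the edge `(u, w)` are composed of rides, and lead from `u` to `w`. -/
def Represents (T : Timetable B Z) (G : Graph B Z) : Prop :=
  ∀ u w, ∀ P ∈ G u w, Path T T.stationGraph u w P

theorem Represents.real {T : Timetable B Z} {G : Graph B Z} (hG : Represents T G) {u w : B}
    {P : Conn B Z} (h : Path T G u w P) : T.Real P := ⟨u, w, h.bind hG⟩

namespace Contracts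

variable {T : Timetable B Z} {v : B} {G G' : Graph B Z}

theorem represents (h : Contracts T v G G') (hG : Represents T G) : Represents T G' := by
  intro u w R hR
  by_cases huw : u = v ∨ w = v
  · simp [h.removed u w huw] at hR
  · push Not at huw
    rcases h.sub u w huw.1 huw.2 hR with hP | ⟨P, Q, hP, hQ, hl, rfl⟩
    · exact hG _ _ _ hP
    · exact (hP.path.snoc hQ hl).bind hG

/-- A path that avoids the contracted node can be replaced after the contraction. -/
theorem exists_replaces_of_pathConn (h : Contracts T v G G') (hG : Represents T G) {u w : B}
    {P : Conn B Z} (hP : PathConn T G v u w P) : ∃ P', Path T G' u w P' ∧ T.Replaces P' P := by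
  -- `merged` needs end points other than `v`, and `canLink` needs the prefix in `G` to be real.
  have key : u ≠ v ∧ w ≠ v ∧ Path T G u w P ∧ ∃ P', Path T G' u w P' ∧ T.Replaces P' P := by
    induction hP with
    | @edge w P hu hw hP =>
      obtain ⟨P', hP', hd⟩ := h.merged u w hu hw P hP
      exact ⟨hu, hw, .edge hP, P', .edge hP', hd.replaces⟩
    | @snoc x w P Q _ hw hQ hl ih =>
      obtain ⟨hu, hx, hP, P', hP', hr⟩ := ih
      obtain ⟨Q', hQ', hd⟩ := h.merged x w hx hw Q hQ
      have hQr := (h.represents hG).real (.edge hQ')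
      exact ⟨hu, hw, hP.snoc hQ hl, P'.link Q',
        hP'.snoc hQ' (hr.canLink hd.replaces (hG.real hP) hQr hl), hr.link hd.replaces⟩
  exact key.2.2.2

/-- The edges of a witness may themselves have been dropped in the merge, so its connection is
replaced once more. -/
theorem exists_replaces_of_shortcut (h : Contracts T v G G') (hG : Represents T G) {u w : B}
    (hu : u ≠ v) (hw : w ≠ v) {P : Conn B Z} (hP : P ∈ shortcut T G v u w) :
    ∃ P', Path T G' u w P' ∧ T.Replaces P' P := by
  rcases h.shortcuts u w hu hw P hP with ⟨P', hP', hd⟩ | ⟨P', hP', hd⟩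
  · exact ⟨P', .edge hP', hd.replaces⟩
  · obtain ⟨P'', hP'', hr⟩ := h.exists_replaces_of_pathConn hG hP'
    exact ⟨P'', hP'', hr.trans hd.replaces⟩

/-- A path from a remaining node can be replaced after the contraction of `v`, except for a last
part that leads to `v` and possibly repeats the loop there. -/
theorem exists_replaces_aux (h : Contracts T v G G') (hG : Represents T G) {u w : B}
    (hu : u ≠ v) {P : Conn B Z} (hP : Path T G u w P) :
    (w ≠ v → ∃ P', Path T G' u w P' ∧ T.Replaces P' P) ∧
    (w = v → LoopConn T G v u P ∨ ∃ x P₁ P₂, x ≠ v ∧ Path T G' u x P₁ ∧ LoopConn T G v x P₂ ∧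
      T.CanLink P₁ P₂ ∧ T.Replaces (P₁.link P₂) P) := by
  have hG' := h.represents hG
  induction hP with
  | @edge w P hP =>
    refine ⟨fun hw => ?_, fun hw => ?_⟩
    · obtain ⟨P', hP', hd⟩ := h.merged u w hu hw P hP
      exact ⟨P', .edge hP', hd.replaces⟩
    · subst hw
      exact .inl (.edge hP)
  | @snoc x w P Q hP hQ hl ih =>
    have hPr := hG.real hP
    by_cases hx : x = v
    · subst hx
      -- The unfinished part at `v` either leaves `v` by `Q` and becomes a shortcut, or is prolonged
      -- by the loop `Q`.
      rcases ih.2 rfl with hL | ⟨y, P₁, P₂, hy, hP₁, hP₂, hl₁, hr⟩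
      · refine ⟨fun hw => h.exists_replaces_of_shortcut hG hu hw ⟨P, Q, hL, hQ, hl, rfl⟩, ?_⟩
        rintro rfl
        exact .inl (hL.loop hQ hl)
      · have hl₂ : T.CanLink (P₁.link P₂) Q := hr.right Q (hG.real (.edge hQ)) hl
        have hrQ : T.Replaces ((P₁.link P₂).link Q) (P.link Q) := hr.link (.refl T Q)
        refine ⟨fun hw => ?_, ?_⟩
        · obtain ⟨Q', hQ', hr'⟩ := h.exists_replaces_of_shortcut hG hy hw
            ⟨P₂, Q, hP₂, hQ, hl₂, rfl⟩
          exact ⟨P₁.link Q', hP₁.append hQ' (hr'.left P₁ (hG'.real hP₁) hl₁),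
            ((Timetable.Replaces.refl T P₁).link hr').trans
              hrQ⟩
        · rintro rfl
          exact .inr ⟨y, P₁, P₂.link Q, hy, hP₁, hP₂.loop hQ hl₂, hl₁,
            hrQ⟩
    · obtain ⟨P', hP', hr⟩ := ih.1 hx
      refine ⟨fun hw => ?_, ?_⟩
      · obtain ⟨Q', hQ', hd⟩ := h.merged x w hx hw Q hQ
        exact ⟨P'.link Q', hP'.snoc hQ' (hr.canLink hd.replaces hPr (hG'.real (.edge hQ')) hl),
          hr.link hd.replaces⟩
      · rintro rfl
        exact .inr ⟨x, P', Q, hx, hP', .edge hQ, hr.right Q (hG.real (.edge hQ)) hl,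
          hr.link (Timetable.Replaces.refl T Q)⟩

end Contracts

/-! ### Paths in the hierarchy -/

namespace Hierarchy

variable {T : Timetable B Z} (H : Hierarchy T)

theorem rank_order (i : Fin H.n) : H.rank (H.order i) = i := by
  simp [rank]

theorem rank_lt (u : B) : H.rank u < H.n := (H.order.symm u).2

theorem order_rank (u : B) : H.order ⟨H.rank u, H.rank_lt u⟩ = u := by
  simp [rank]

theorem rank_injective {u w : B} (h : H.rank u = H.rank w) : u = w := by
  rw [← H.order_rank u, ← H.order_rank w]
  simp only [h]

theorem graph_represents {i : ℕ} (hi : i ≤ H.n) : Represents T (H.graph i) := by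
  induction i with
  | zero => exact H.graph_zero ▸ fun u w P hP => .edge hP
  | succ i ih => exact (H.contracts ⟨i, hi⟩).represents (ih (by omega))

theorem edge_real {u w : B} {P : Conn B Z} (hP : P ∈ H.edge u w) : T.Real P :=
  (H.graph_represents (by have := H.rank_lt u; omega)).real (.edge hP)

theorem edge_path {u w : B} {P : Conn B Z} (hP : P ∈ H.edge u w) :
    Path T T.stationGraph u w P :=
  H.graph_represents (by have := H.rank_lt u; omega) u w P hP

/-- Only the stations that have not been contracted have edges. -/
theorem le_rank_of_mem {i : ℕ} (hi : i ≤ H.n) {u w : B} {P : Conn B Z} (hP : P ∈ H.graph i u w) :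
    i ≤ H.rank u ∧ i ≤ H.rank w := by
  induction i generalizing u w P with
  | zero => simp
  | succ i ih =>
    have hc := H.contracts ⟨i, hi⟩
    by_cases huw : u = H.order ⟨i, hi⟩ ∨ w = H.order ⟨i, hi⟩
    · simp [hc.removed u w huw] at hP
    push Not at huw
    have hne : ∀ x, x ≠ H.order ⟨i, hi⟩ → H.rank x ≠ i := fun x hx h =>
      hx (H.rank_injective (h.trans (H.rank_order ⟨i, hi⟩).symm))
    have hu := hne u huw.1
    have hw := hne w huw.2
    suffices i ≤ H.rank u ∧ i ≤ H.rank w by omega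
    rcases hc.sub u w huw.1 huw.2 hP with hP | ⟨P, Q, hP, hQ, -, -⟩
    · exact ih (by omega) hP
    · refine ⟨?_, (ih (by omega) hQ).2⟩
      clear hQ
      induction hP with
      | edge hP => exact (ih (by omega) hP).1
      | loop _ _ _ ih' => exact ih'

/-- The downward edges of the hierarchy. -/
def Down (u w : B) : Prop := (H.edge u w).Nonempty ∧ H.rank w < H.rank u

/-- The edges that lead upwards, the loops, and those on a downward path to the target `b`. -/
def searchGraph (b : B) : Graph B Z := fun u w =>
  {P | P ∈ H.edge u w ∧ (H.rank u ≤ H.rank w ∨ Relation.ReflTransGen H.Down w b)}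

theorem searchGraph_represents (b : B) : Represents T (H.searchGraph b) :=
  fun _ _ _ hP => H.edge_path hP.1

theorem searchGraph_subset {b c : B} (h : Relation.ReflTransGen H.Down b c) (u w : B) :
    H.searchGraph b u w ⊆ H.searchGraph c u w :=
  fun _ hP => ⟨hP.1, hP.2.imp_right fun h' => h'.trans h⟩

/-- Along each path of a remaining graph there is a path that first leads upwards and then
downwards, with loops in between, which can replace it. -/
theorem exists_searchGraph_path {i : ℕ} (hi : i ≤ H.n) {u w : B} {P : Conn B Z}
    (hP : Path T (H.graph i) u w P) :
    ∃ P', Path T (H.searchGraph w) u w P' ∧ T.Replaces P' P := by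
  induction hk : H.n - i generalizing i u w P with
  | zero =>
    -- After all contractions no edge is left.
    exfalso
    obtain rfl : i = H.n := by omega
    have : ∃ P x, P ∈ H.graph H.n x w := by
      cases hP with
      | edge h => exact ⟨_, _, h⟩
      | snoc _ h _ => exact ⟨_, _, h⟩
    obtain ⟨P, x, hP⟩ := this
    have := H.le_rank_of_mem le_rfl hP
    have := H.rank_lt w
    omega
  | succ k ih =>
    have hin : i < H.n := by omega
    obtain ⟨v, hv⟩ : ∃ v, v = H.order ⟨i, hin⟩ := ⟨_, rfl⟩
    have hc : Contracts T v (H.graph i) (H.graph (i + 1)) := hv ▸ H.contracts ⟨i, hin⟩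
    have hvi : H.rank v = i := hv ▸ H.rank_order ⟨i, hin⟩
    have hG := H.graph_represents hi
    have hlt : ∀ {x y P}, P ∈ H.graph i x y → x ≠ v → i < H.rank x := fun h hx =>
      lt_of_le_of_ne (H.le_rank_of_mem hi h).1
        (fun h' => hx (H.rank_injective (h'.symm.trans hvi.symm)))
    -- `v` is contracted next, so its present edges are already those of the hierarchy.
    have hloop : ∀ {x P}, x ≠ v → LoopConn T (H.graph i) v x P →
        H.Down x v ∧ Path T (H.searchGraph v) x v P := by
      intro x P hx hP
      induction hP with
      | @edge P hP =>
        have hr := hlt hP hx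
        have he : P ∈ H.edge x v := by
          rwa [edge, min_eq_right (by omega), hvi]
        exact ⟨⟨⟨_, he⟩, by omega⟩, .edge ⟨he, .inr .refl⟩⟩
      | loop _ hQ hl ih =>
        refine ⟨ih.1, ih.2.snoc ⟨?_, .inl le_rfl⟩ hl⟩
        rwa [edge, min_self, hvi]
    -- Off `v`, the path moves on to the next graph. If it ends in `v`, its replaced part ends at
    -- some `x` above `v`, and the downward edge from `x` to `v` puts the corridor of `x` into that
    -- of `v`.
    have hne : ∀ {u w P}, u ≠ v → Path T (H.graph i) u w P →
        ∃ P', Path T (H.searchGraph w) u w P' ∧ T.Replaces P' P := by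
      intro u w P hu hP
      have haux := hc.exists_replaces_aux hG hu hP
      by_cases hw : w = v
      · subst hw
        rcases haux.2 rfl with hL | ⟨x, P₁, P₂, hx, hP₁, hP₂, hl, hr⟩
        · exact ⟨P, (hloop hu hL).2, .refl T P⟩
        · obtain ⟨P₁', hP₁', hr₁⟩ := ih hin hP₁ (by omega)
          obtain ⟨hd, hP₂'⟩ := hloop hx hP₂
          refine ⟨P₁'.link P₂, (hP₁'.mono (H.searchGraph_subset (.single hd))).append hP₂'
            (hr₁.right P₂ (hG.real hP₂.path) hl), (hr₁.link (.refl T P₂)).trans hr⟩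
      · obtain ⟨P₁, hP₁, hr⟩ := haux.1 hw
        obtain ⟨P₂, hP₂, hr'⟩ := ih hin hP₁ (by omega)
        exact ⟨P₂, hP₂, hr'.trans hr⟩
    have hup : ∀ {y w P}, P ∈ H.graph i v y → P ∈ H.searchGraph w v y := by
      intro y w P hP
      have := (H.le_rank_of_mem hi hP).2
      refine ⟨?_, .inl (by omega)⟩
      rwa [edge, min_eq_left (by omega), hvi]
    -- Initial edges out of `v` lead upwards or are loops and are kept one by one; from the first
    -- other station on, `hne` handles the whole rest.
    refine hP.head_induction (motive := fun u P => ∃ P', Path T (H.searchGraph w) u w P' ∧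
      T.Replaces P' P) ?_ ?_
    · intro u P hP
      by_cases hu : u = v
      · subst hu
        exact ⟨P, .edge (hup hP), .refl T P⟩
      · exact hne hu (.edge hP)
    · intro u x P Q hP hQ hl ⟨Q', hQ', hr⟩
      by_cases hu : u = v
      · subst hu
        exact ⟨P.link Q', (Path.edge (hup hP)).append hQ' (hr.left P (hG.real (.edge hP)) hl),
          (Timetable.Replaces.refl T P).link hr⟩
      · exact hne hu ((Path.edge hP).append hQ hl)

end Hierarchy

namespace Timetable

variable {T : Timetable B Z}

/-! ### Consistent connections as paths in the station graph -/

/-- The clause on the last stop event serves the induction: it decides how the next ride may follow.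
-/
theorem exists_isConsistent {u w : B} {P : Conn B Z} (h : Path T T.stationGraph u w P) :
    ∃ L, T.IsConsistent L u w P.dep P.arr ∧ ∃ x, L.getLast? = some x ∧ x.1.Z2 = P.Z2 := by
  induction h with
  | edge h =>
    obtain ⟨c, d, hr, h1, h2, rfl⟩ := h
    exact ⟨[(c, d)], ⟨by simpa using hr, by simp, ⟨(c, d), by simp, h1, rfl⟩,
      ⟨(c, d), by simp, h2, rfl⟩⟩, (c, d), by simp, rfl⟩
  | @snoc x w P Q hP h hl ih =>
    obtain ⟨c, d, hr, h1, h2, rfl⟩ := h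
    obtain ⟨L, ⟨hR, hC, ⟨y, hy, hy1, hy2⟩, ⟨z, hz, hz1, hz2⟩⟩, z', hz', hz3⟩ := ih
    obtain rfl : z = z' := Option.some_injective _ (hz.symm.trans hz')
    obtain ⟨_, -, -, -, hP2, -⟩ := path_last hP
    refine ⟨L ++ [(c, d)], ⟨?_, ?_, ⟨y, ?_, hy1, hy2⟩, ⟨(c, d), by simp, h2, rfl⟩⟩,
      (c, d), by simp, rfl⟩
    · intro r hr'
      rcases List.mem_append.1 hr' with h | h
      · exact hR r h
      · rw [List.mem_singleton.1 h]
        exact hr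
    · refine List.isChain_append.2 ⟨hC, by simp, ?_⟩
      intro r hr' s hs
      rw [hz] at hr'
      obtain rfl : z = r := by simpa using hr'
      obtain rfl : (c, d) = s := by simpa using hs
      have := hl.2
      refine ⟨hz1.trans h1.symm, ?_⟩
      rw [hz1, hz3, hz2, ← hP2]
      exact this
    · rw [List.head?_append, hy]
      rfl

theorem exists_path_of_isChain {L : List (ElemConn B Z × ℤ)} {x y : ElemConn B Z × ℤ}
    (hR : ∀ z ∈ x :: L, T.Runs z) (hC : (x :: L).IsChain T.Follows)
    (hy : (x :: L).getLast? = some y) :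
    ∃ P, Path T T.stationGraph x.1.S1 y.1.S2 P ∧ P.Z1 = x.1.Z1 ∧ P.dep = x.2 ∧
      P.arr = y.1.length + y.2 := by
  have hx : (⟨x.1.Z1, x.1.Z2, x.1.S1, x.1.S2, x.2, x.1.length + x.2⟩ : Conn B Z) ∈
      T.stationGraph x.1.S1 x.1.S2 := ⟨x.1, x.2, hR x (by simp), rfl, rfl, rfl⟩
  induction L generalizing x with
  | nil =>
    obtain rfl : x = y := by simpa using hy
    exact ⟨_, .edge hx, rfl, rfl, rfl⟩
  | cons x' L ih =>
    rw [List.isChain_cons_cons] at hC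
    obtain ⟨P, hP, h1, h2, h3⟩ := ih (fun z hz => hR z (List.mem_cons_of_mem _ hz)) hC.2
      (by simpa using hy) ⟨x'.1, x'.2, hR x' (by simp), rfl, rfl, rfl⟩
    obtain ⟨_, -, -, -, hP1, -⟩ := path_head hP
    obtain ⟨hS, hw⟩ := hC.1
    refine ⟨_, (Path.edge hx).append (hS ▸ hP) ⟨hS.trans hP1.symm, ?_⟩, rfl, rfl, h3⟩
    rw [h1, h2]
    exact hw

theorem IsConsistent.exists_path {L : List (ElemConn B Z × ℤ)} {a b : B} {d t : ℤ}
    (h : T.IsConsistent L a b d t) :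
    ∃ P, Path T T.stationGraph a b P ∧ P.dep = d ∧ P.arr = t := by
  obtain ⟨hR, hC, ⟨x, hx, rfl, rfl⟩, ⟨y, hy, rfl, rfl⟩⟩ := h
  cases L with
  | nil => simp at hx
  | cons z L =>
    obtain rfl : z = x := by simpa using hx
    obtain ⟨P, hP, -, h1, h2⟩ := exists_path_of_isChain hR hC hy
    exact ⟨P, hP, h1, h2⟩

theorem reaches_iff {a b : B} {t₀ t : ℤ} :
    T.Reaches a b t₀ t ↔
      (b = a ∧ t = t₀) ∨ ∃ P, Path T T.stationGraph a b P ∧ t₀ ≤ P.dep ∧ P.arr = t := by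
  refine or_congr_right ⟨?_, ?_⟩
  · rintro ⟨L, d, hL, hd⟩
    obtain ⟨P, hP, rfl, rfl⟩ := hL.exists_path
    exact ⟨P, hP, hd, rfl⟩
  · rintro ⟨P, hP, hd, rfl⟩
    obtain ⟨L, hL, -⟩ := exists_isConsistent hP
    exact ⟨L, _, hL, hd⟩

/-! ### Arrival connections -/

theorem DominatesArr.refl (T : Timetable B Z) (S : B) (P : Arrival Z) : T.DominatesArr S P P := by
  rcases P with ⟨t, _ | z⟩ <;> simp [DominatesArr]

theorem IsNextDep.mono {S : B} {z : Z} {d d' t t' : ℤ} (h : T.IsNextDep S z d t)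
    (h' : T.IsNextDep S z d' t') (hd : d ≤ d') : t ≤ t' := by
  obtain ⟨c, hc, h1, h2, rfl⟩ := h
  obtain ⟨c', hc', h1', h2', rfl⟩ := h'
  obtain rfl := T.dep_unique c hc c' hc' (h1.trans h1'.symm) (h2.trans h2'.symm)
  unfold cycleDiff
  omega

theorem IsNextDep.exists_of {S : B} {z : Z} {d t : ℤ} (h : T.IsNextDep S z d t) (d' : ℤ) :
    ∃ t', T.IsNextDep S z d' t' := by
  obtain ⟨c, hc, h1, h2, -⟩ := h
  exact ⟨_, c, hc, h1, h2, rfl⟩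

/-- The essential case is that `Q` and `R` share a stop event. Its next departure is monotone in the
arrival time, so a transfer in time for the departure after `Q` is in time for the one after `R`. -/
theorem DominatesArr.trans {S : B} {P Q R : Arrival Z} (h : T.DominatesArr S P Q)
    (h' : T.DominatesArr S Q R) : T.DominatesArr S P R := by
  obtain ⟨hPQ, h⟩ := h
  obtain ⟨hQR, h'⟩ := h'
  refine ⟨hPQ.trans hQR, ?_⟩
  rcases P with ⟨p, _ | zp⟩
  · trivial
  rcases Q with ⟨q, _ | zq⟩
  · exact h.elim
  rcases R with ⟨r, _ | zr⟩
  · exact h'.elim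
  dsimp only at *
  rcases h' with rfl | h' | ⟨t, ht, h'⟩
  · rcases h with h | h | ⟨t, ht, h⟩
    · exact .inl h
    · by_cases hc : T.CriticalArr S zr r
      · obtain ⟨t, ht, htr⟩ := hc
        obtain ⟨t', ht'⟩ := ht.exists_of q
        have := ht'.mono ht hQR
        have : ¬ t' - q < T.transfer S := fun h1 => h ⟨t', ht', h1⟩
        exact .inr (.inr ⟨t, ht, by omega⟩)
      · exact .inr (.inl hc)
    · obtain ⟨t', ht'⟩ := ht.exists_of r
      have := ht.mono ht' hQR
      exact .inr (.inr ⟨t', ht', by omega⟩)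
  · exact .inr (.inl h')
  · exact .inr (.inr ⟨t, ht, by omega⟩)

theorem CanBoard.arr_le_dep {S : B} {P : Arrival Z} {R : Conn B Z} (h : T.CanBoard S P R) :
    P.arr ≤ R.dep := by
  rcases P with ⟨p, _ | z⟩
  · exact h
  · have := T.minWait_nonneg S z R.Z1
    have h : T.minWait S z R.Z1 ≤ R.dep - p := h
    show p ≤ R.dep
    omega

/-- Dominating arrival connections allow boarding the same trains. -/
theorem DominatesArr.canBoard {S : B} {P Q : Arrival Z} {R : Conn B Z}
    (h : T.DominatesArr S P Q) (hR : T.Real R) (hS : R.S1 = S) (hl : T.CanBoard S Q R) :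
    T.CanBoard S P R := by
  have hle := hl.arr_le_dep
  subst hS
  obtain ⟨hPQ, h⟩ := h
  rcases P with ⟨p, _ | zp⟩
  · exact hPQ.trans hle
  rcases Q with ⟨q, _ | zq⟩
  · exact h.elim
  have hl : T.minWait R.S1 zq R.Z1 ≤ R.dep - q := hl
  show T.minWait R.S1 zp R.Z1 ≤ R.dep - p
  have hw := T.minWait_le R.S1 zp R.Z1
  dsimp only at *
  by_cases hz : R.Z1 = zq
  · subst hz
    rcases h with rfl | h | ⟨t, ht, h⟩
    · rw [minWait_self]
      omega
    · obtain ⟨t, ht⟩ := hR.exists_nextDep q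
      have := hR.nextDep_le ht hle
      have : ¬ t - q < T.transfer R.S1 := fun h1 => h ⟨t, ht, h1⟩
      omega
    · have := hR.nextDep_le ht hle
      omega
  · rw [minWait_of_ne hz] at hl
    omega

/-- Domination is only a preorder, so one representative is chosen from each class of maximal
elements, an old one if the class has any. -/
theorem exists_isMinimum (S : B) {old new : Set (Arrival Z)} (h : (old ∪ new).Finite) :
    ∃ N, T.IsMinimum S old new N := by
  classical
  let : Preorder (Arrival Z) :=
    { le := fun Q P => T.DominatesArr S P Q
      le_refl := DominatesArr.refl T S
      le_trans := fun _ _ _ h h' => h'.trans h }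
  let best : Set (Arrival Z) := {P | Maximal (· ∈ old ∪ new) P}
  have hbest : ∀ Q ∈ old ∪ new, ∃ P ∈ best, T.DominatesArr S P Q := fun Q hQ => by
    obtain ⟨P, hle, hP⟩ := h.exists_le_maximal hQ
    exact ⟨P, hP, hle⟩
  -- An old element above a maximal one is equivalent to it. Hence a representative that is not old
  -- is dominated by no old element.
  have hrep : ∀ P : Arrival Z, ∃ P', (∃ R ∈ best, R ≤ P ∧ P ≤ R) →
      (P' ∈ best ∧ P ≤ P' ∧ P' ≤ P ∧ (P' ∉ old → ∀ R ∈ old, ¬ P ≤ R)) := fun P => by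
    by_cases hR : ∃ R ∈ old, P ≤ R
    · obtain ⟨R, hR, hle⟩ := hR
      refine ⟨R, fun ⟨P₀, hP₀, h1, h2⟩ => ?_⟩
      have h3 : R ≤ P₀ := hP₀.2 (.inl hR) (h1.trans hle)
      exact ⟨⟨.inl hR, fun Q hQ hRQ => (hP₀.2 hQ (h1.trans (hle.trans hRQ))).trans (h1.trans hle)⟩,
        hle, h3.trans h1, fun h => (h hR).elim⟩
    · push Not at hR
      by_cases hP : ∃ R ∈ best, R ≤ P ∧ P ≤ R
      · obtain ⟨R, h1, h2, h3⟩ := hP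
        exact ⟨R, fun _ => ⟨h1, h3, h2, fun _ => hR⟩⟩
      · exact ⟨P, fun h => (hP h).elim⟩
  choose f hf using hrep
  let s := AntisymmRel.setoid (Arrival Z) (· ≤ ·)
  -- `f` need not be constant on classes; composing it with `rep` makes it so.
  let rep : Arrival Z → Arrival Z := fun P => (Quotient.mk s P).out
  have hle : ∀ P, rep P ≤ P := fun P => (Quotient.mk_out (s := s) P).1
  have hge : ∀ P, P ≤ rep P := fun P => (Quotient.mk_out (s := s) P).2
  have hrep : ∀ P P', P ≤ P' → P' ≤ P → rep P = rep P' := fun P P' h h' =>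
    congrArg Quotient.out (Quotient.sound (s := s) ⟨h, h'⟩)
  have hmem : ∀ P ∈ best, ∃ R ∈ best, R ≤ rep P ∧ rep P ≤ R := fun P hP => ⟨P, hP, hge P, hle P⟩
  refine ⟨(f ∘ rep) '' best, ?_, ?_, ?_, ?_⟩
  · rintro _ ⟨P, hP, rfl⟩
    exact (hf _ (hmem P hP)).1.1
  · intro Q hQ
    obtain ⟨P, hP, hd⟩ := hbest Q hQ
    have h' : P ≤ f (rep P) := (hge P).trans (hf _ (hmem P hP)).2.1
    exact ⟨_, ⟨P, hP, rfl⟩, DominatesArr.trans h' hd⟩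
  · rintro _ ⟨P, hP, rfl⟩ _ ⟨Q, hQ, rfl⟩ hd
    obtain ⟨-, h2, h3, -⟩ := hf _ (hmem P hP)
    obtain ⟨h1', h2', h3', -⟩ := hf _ (hmem Q hQ)
    have h4 : Q ≤ P := (hge Q).trans (h2'.trans (LE.le.trans hd (h3.trans (hle P))))
    exact congrArg f (hrep P Q (hQ.2 hP.1 h4) h4)
  · rintro _ ⟨P, hP, rfl⟩ hn R hR hd
    obtain ⟨-, h2, -, h4⟩ := hf _ (hmem P hP)
    exact h4 hn R hR (h2.trans hd)

end Timetable

/-! ### Finiteness and soundness of the stored arrivals. -/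

namespace Timetable

theorem finite_setOf_runs (T : Timetable B Z) : {x | T.Runs x}.Finite := by
  classical
  refine (T.conns.biUnion fun c => (T.days c).image fun n => (c, 1440 * n + c.td)).finite_toSet.subset
    ?_
  rintro ⟨c, d⟩ ⟨hc, hd, hm⟩
  have h := T.td_mem c hc
  simp only [Int.ModEq] at hm
  simp only [Finset.coe_biUnion, Set.mem_iUnion, Finset.coe_image, Set.mem_image]
  refine ⟨c, hc, d / 1440, hd, Prod.ext rfl ?_⟩
  dsimp only at *
  omega

/-- A finite set that contains all arrival connections of a time query. -/
def labels (T : Timetable B Z) (t₀ : ℤ) : Set (Arrival Z) :=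
  insert ⟨t₀, none⟩ ((fun x => ⟨x.1.length + x.2, some x.1.Z2⟩) '' {x | T.Runs x})

theorem finite_labels (T : Timetable B Z) (t₀ : ℤ) : (T.labels t₀).Finite :=
  (T.finite_setOf_runs.image _).insert _

/-- The arrival connection `L` at `S` is the initial one or the arrival of a connection from `a`
that departs not before `t₀`. -/
def IsLabel (T : Timetable B Z) (a : B) (t₀ : ℤ) (S : B) (L : Arrival Z) : Prop :=
  (S = a ∧ L = ⟨t₀, none⟩) ∨
    ∃ P, Path T T.stationGraph a S P ∧ t₀ ≤ P.dep ∧ L = ⟨P.arr, some P.Z2⟩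

variable {T : Timetable B Z} {a S S' : B} {t₀ : ℤ} {L : Arrival Z}

theorem IsLabel.mem_labels (h : T.IsLabel a t₀ S L) : L ∈ T.labels t₀ := by
  rcases h with ⟨-, rfl⟩ | ⟨P, hP, -, rfl⟩
  · exact Set.mem_insert _ _
  · obtain ⟨x, hx, -, h1, -, h2⟩ := path_last hP
    exact Set.mem_insert_of_mem _ ⟨x, hx, by rw [← h1, h2]⟩

theorem IsLabel.reaches (h : T.IsLabel a t₀ S L) : T.Reaches a S t₀ L.arr := by
  rcases h with ⟨h, rfl⟩ | ⟨P, hP, hd, rfl⟩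
  · exact .inl ⟨h, rfl⟩
  · exact reaches_iff.2 (.inr ⟨P, hP, hd, rfl⟩)

theorem IsLabel.linkArr {X : Set (Arrival Z)} {E : Set (Conn B Z)}
    (hX : ∀ L ∈ X, T.IsLabel a t₀ S L) (hE : ∀ P ∈ E, Path T T.stationGraph S S' P)
    (hL : L ∈ T.linkArr S X E) : T.IsLabel a t₀ S' L := by
  obtain ⟨L, hL, P, hP, hb, rfl⟩ := hL
  refine .inr ?_
  rcases hX L hL with ⟨rfl, rfl⟩ | ⟨R, hR, hd, rfl⟩
  · exact ⟨P, hE P hP, hb, rfl⟩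
  · obtain ⟨_, -, -, -, h1, -⟩ := path_last hR
    obtain ⟨_, -, -, -, h2, -⟩ := path_head (hE P hP)
    refine ⟨R.link P, hR.append (hE P hP) ⟨h1.trans h2.symm, ?_⟩, hd, rfl⟩
    rw [h1]
    exact hb

end Timetable

namespace Hierarchy

variable {T : Timetable B Z} {H : Hierarchy T} {a b : B} {t₀ : ℤ}

/-! ### The invariant of the time query -/

/-- The invariant of the forward search, where the edges in `pending` are yet to be processed. -/
structure SearchInv (H : Hierarchy T) (a b : B) (t₀ : ℤ) (pending : B → B → Prop)
    (corridor : Set B) (ac : B → Set (Arrival Z)) (Q : B → Option ℤ) : Prop where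
  corridor_mem : ∀ S, Relation.ReflTransGen H.Down S b → S ∈ corridor
  isLabel : ∀ S, ∀ L ∈ ac S, T.IsLabel a t₀ S L
  antichain : ∀ S, ∀ P ∈ ac S, ∀ R ∈ ac S, T.DominatesArr S P R → P = R
  start : ∃ L ∈ ac a, T.DominatesArr a L ⟨t₀, none⟩
  key : ∀ S k, Q S = some k → IsLeast (Arrival.arr '' ac S) k
  target : (ac b).Nonempty → Q b ≠ none
  settled : ∀ S, Q S = none → ∀ S', H.SearchEdge corridor S S' → ¬ pending S S' →
    ∀ R ∈ T.linkArr S (ac S) (H.edge S S'), ∃ P ∈ ac S', T.DominatesArr S' P R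

/-- The invariant of the time query. -/
def Inv (H : Hierarchy T) (a b : B) (t₀ : ℤ) : Config B Z → Prop
  | .backward queue visited =>
    b ∈ visited ∧ ∀ S' ∈ visited, S' ∉ queue → ∀ S, H.Down S S' → S ∈ visited
  | .forward corridor ac Q => H.SearchInv a b t₀ (fun _ _ => False) corridor ac Q
  | .relaxing corridor S todo ac Q =>
    H.SearchInv a b t₀ (fun x y => x = S ∧ y ∈ todo) corridor ac Q
  | .done r => T.SolvesEAP a b t₀ r

namespace SearchInv

variable {pending : B → B → Prop} {corridor : Set B} {ac : B → Set (Arrival Z)}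
  {Q : B → Option ℤ}

/-- Each path of the search is dominated by the arrival connections, unless a station with a smaller
key is in the queue. -/
theorem exists_dominatesArr (h : H.SearchInv a b t₀ (fun _ _ => False) corridor ac Q) {x : B}
    {P : Conn B Z} (hP : Path T (H.searchGraph b) a x P) (hd : t₀ ≤ P.dep)
    (hQ : ∀ S k, Q S = some k → P.arr < k) :
    ∃ L ∈ ac x, T.DominatesArr x L ⟨P.arr, some P.Z2⟩ := by
  -- A queued station has its least arrival as key, which is at most the time of boarding and hence
  -- at most `P.arr`. So the boarding station is not queued, and `settled` applies.
  have step : ∀ {S S' P L}, P ∈ H.searchGraph b S S' → L ∈ ac S → T.CanBoard S L P →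
      (∀ S k, Q S = some k → P.arr < k) →
      ∃ L' ∈ ac S', T.DominatesArr S' L' ⟨P.arr, some P.Z2⟩ := by
    intro S S' P L hP hL hb hQ
    have hS : Q S = none := by
      by_contra hne
      obtain ⟨k, hk⟩ := Option.ne_none_iff_exists'.1 hne
      have h1 := hQ S k hk
      have h2 := (h.key S k hk).2 ⟨L, hL, rfl⟩
      have h3 := hb.arr_le_dep
      have h4 := Timetable.path_dep_le_arr (H.edge_path hP.1)
      omega
    exact h.settled S hS S' ⟨⟨P, hP.1⟩, hP.2.imp_right (h.corridor_mem S')⟩ id _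
      ⟨L, hL, P, hP.1, hb, rfl⟩
  induction hP with
  | @edge w P hP =>
    obtain ⟨L, hL, hdom⟩ := h.start
    obtain ⟨_, -, -, -, h1, -⟩ := Timetable.path_head (H.edge_path hP.1)
    exact step hP hL (hdom.canBoard (H.edge_real hP.1) h1 hd) hQ
  | @snoc x w P R hP hR hl ih =>
    have h1 := Timetable.path_dep_le_arr (H.edge_path hR.1)
    have h2 := hl.arr_le_dep
    obtain ⟨L, hL, hdom⟩ := ih hd (fun S k hk => by
      have h3 : R.arr < k := hQ S k hk
      omega)
    obtain ⟨_, -, -, -, h3, -⟩ := Timetable.path_head (H.edge_path hR.1)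
    obtain ⟨_, -, -, -, h4, -⟩ :=
      Timetable.path_last (hP.bind (H.searchGraph_represents b))
    refine step (P := R) hR hL (hdom.canBoard (H.edge_real hR.1) h3 ?_) hQ
    have h5 := hl.2
    rw [h4] at h5
    exact h5

/-- If all keys in the queue exceed `t`, then everything that arrives at the target until `t` has
been found. -/
theorem exists_arr_le (h : H.SearchInv a b t₀ (fun _ _ => False) corridor ac Q) {t : ℤ}
    (ht : T.Reaches a b t₀ t) (hQ : ∀ S k, Q S = some k → t < k) : ∃ L ∈ ac b, L.arr ≤ t := by
  rcases Timetable.reaches_iff.1 ht with ⟨rfl, rfl⟩ | ⟨P, hP, hd, rfl⟩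
  · obtain ⟨L, hL, hdom⟩ := h.start
    exact ⟨L, hL, hdom.1⟩
  · rw [← H.graph_zero] at hP
    obtain ⟨P', hP', hr⟩ := H.exists_searchGraph_path (Nat.zero_le _) hP
    obtain ⟨L, hL, hdom⟩ := h.exists_dominatesArr hP' (hd.trans hr.dep)
      fun S k hk => hr.arr.trans_lt (hQ S k hk)
    exact ⟨L, hL, hdom.1.trans hr.arr⟩

/-- The key is an arrival stored at `b`, hence attained. An earlier reachable time would lie below
all keys, so an arrival earlier than the key would be stored at `b`. -/
theorem solvesEAP_some (h : H.SearchInv a b t₀ (fun _ _ => False) corridor ac Q) {t : ℤ}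
    (hb : Q b = some t) (hQ : ∀ S k, Q S = some k → t ≤ k) : T.SolvesEAP a b t₀ (some t) := by
  obtain ⟨⟨L, hL, rfl⟩, hleast⟩ := h.key b t hb
  refine ⟨(h.isLabel b L hL).reaches, fun t' ht' => ?_⟩
  by_contra hlt
  obtain ⟨L', hL', hle⟩ := h.exists_arr_le ht' fun S k hk => (not_le.1 hlt).trans_le (hQ S k hk)
  exact hlt ((hleast ⟨L', hL', rfl⟩).trans hle)

/-- The target is never deleted from the queue to be relaxed, so with an empty queue it has no
arrivals (`target`). -/
theorem solvesEAP_none (h : H.SearchInv a b t₀ (fun _ _ => False) corridor ac Q)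
    (hQ : ∀ S, Q S = none) : T.SolvesEAP a b t₀ none := by
  intro t ht
  obtain ⟨L, hL, -⟩ := h.exists_arr_le ht fun S k hk => by simp [hQ S] at hk
  exact h.target ⟨L, hL⟩ (hQ b)

theorem isLabel_of_isMinimum (h : H.SearchInv a b t₀ pending corridor ac Q) {S S' : B}
    {N : Set (Arrival Z)}
    (hN : T.IsMinimum S' (ac S') (T.linkArr S (ac S) (H.edge S S')) N) :
    ∀ L ∈ N, T.IsLabel a t₀ S' L := by
  intro L hL
  rcases hN.sub hL with hL | hL
  · exact h.isLabel S' L hL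
  · exact .linkArr (h.isLabel S) (fun P hP => H.edge_path hP) hL

open Classical in
theorem init (hc : ∀ S, Relation.ReflTransGen H.Down S b → S ∈ corridor) :
    H.SearchInv a b t₀ (fun _ _ => False) corridor
      (Function.update (fun _ => ∅) a {⟨t₀, none⟩})
      (Function.update (fun _ => none) a (some t₀)) := by
  have hac : ∀ S (L : Arrival Z),
      L ∈ (Function.update (fun _ => ∅) a {⟨t₀, none⟩} : B → Set (Arrival Z)) S ↔
        S = a ∧ L = ⟨t₀, none⟩ := by
    intro S L
    by_cases hS : S = a
    · subst hS
      simp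
    · simp [hS]
  refine ⟨hc, fun S L hL => .inl ((hac S L).1 hL), ?_, ⟨_, (hac _ _).2 ⟨rfl, rfl⟩, .refl T a _⟩,
    ?_, ?_, ?_⟩
  · intro S P hP R hR _
    rw [((hac _ _).1 hP).2, ((hac _ _).1 hR).2]
  · intro S k hk
    by_cases hS : S = a
    · subst hS
      obtain rfl : t₀ = k := by simpa using hk
      simp
    · simp [hS] at hk
  · rintro ⟨L, hL⟩
    obtain ⟨rfl, -⟩ := (hac _ _).1 hL
    simp
  · rintro S hS S' - - R ⟨L, hL, -⟩
    obtain ⟨rfl, -⟩ := (hac _ _).1 hL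
    simp at hS

open Classical in
theorem deleteMin (h : H.SearchInv a b t₀ (fun _ _ => False) corridor ac Q) {S : B}
    (hS : S ≠ b) : H.SearchInv a b t₀ (fun x y => x = S ∧ y ∈ {S' | H.SearchEdge corridor S S'})
      corridor ac (Function.update Q S none) := by
  refine ⟨h.corridor_mem, h.isLabel, h.antichain, h.start, fun x k hk => ?_, fun hb => ?_, ?_⟩
  · by_cases hx : x = S
    · subst hx
      simp at hk
    · exact h.key x k (by simpa [hx] using hk)
  · simpa [hS.symm] using h.target hb
  · intro x hx y hxy hp
    have hne : x ≠ S := fun hx => hp ⟨hx, hx ▸ hxy⟩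
    exact h.settled x (by simpa [hne] using hx) y hxy id

theorem keep {S S' : B} {todo : Set B}
    (h : H.SearchInv a b t₀ (fun x y => x = S ∧ y ∈ todo) corridor ac Q)
    (hN : T.IsMinimum S' (ac S') (T.linkArr S (ac S) (H.edge S S')) (ac S')) :
    H.SearchInv a b t₀ (fun x y => x = S ∧ y ∈ todo \ {S'}) corridor ac Q := by
  refine ⟨h.corridor_mem, h.isLabel, h.antichain, h.start, h.key, h.target, ?_⟩
  intro x hx y hxy hp R hR
  by_cases hp' : x = S ∧ y ∈ todo
  · obtain rfl : y = S' := by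
      by_contra hy
      exact hp ⟨hp'.1, hp'.2, hy⟩
    obtain ⟨rfl, -⟩ := hp'
    exact hN.dominating R (.inr hR)
  · exact h.settled x hx y hxy hp' R hR

open Classical in
theorem improve {S S' : B} {todo : Set B} {N : Set (Arrival Z)} {k : ℤ}
    (h : H.SearchInv a b t₀ (fun x y => x = S ∧ y ∈ todo) corridor ac Q)
    (hN : T.IsMinimum S' (ac S') (T.linkArr S (ac S) (H.edge S S')) N)
    (hk : IsLeast (Arrival.arr '' N) k) :
    H.SearchInv a b t₀ (fun x y => x = S ∧ y ∈ todo \ {S'}) corridor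
      (Function.update ac S' N) (Function.update Q S' (some k)) := by
  refine ⟨h.corridor_mem, fun x => ?_, fun x => ?_, ?_, fun x l hl => ?_, ?_, ?_⟩
  · by_cases hx : x = S'
    · subst hx
      simpa using h.isLabel_of_isMinimum hN
    · simpa [hx] using h.isLabel x
  · by_cases hx : x = S'
    · subst hx
      simpa using hN.dominant
    · simpa [hx] using h.antichain x
  · obtain ⟨L, hL, hdom⟩ := h.start
    by_cases hx : a = S'
    · subst hx
      obtain ⟨P, hP, hdom'⟩ := hN.dominating L (.inl hL)
      exact ⟨P, by simpa using hP, hdom'.trans hdom⟩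
    · exact ⟨L, by simpa [hx] using hL, hdom⟩
  · by_cases hx : x = S'
    · subst hx
      obtain rfl : k = l := by simpa using hl
      simpa using hk
    · simpa [hx] using h.key x l (by simpa [hx] using hl)
  · by_cases hx : b = S'
    · subst hx
      simp
    · simpa [hx] using h.target
  · intro x hx y hxy hp R hR
    -- The changed station is queued again, so nothing is claimed about its outgoing edges. This
    -- covers a loop that changes the arrivals at `S` while its edges are being relaxed.
    have hxS : x ≠ S' := by
      rintro rfl
      simp at hx
    replace hx : Q x = none := by simpa [hxS] using hx
    rw [Function.update_of_ne hxS] at hR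
    by_cases hy : y = S'
    · subst hy
      rw [Function.update_self]
      by_cases hp' : x = S ∧ y ∈ todo
      · obtain ⟨rfl, -⟩ := hp'
        exact hN.dominating R (.inr hR)
      · obtain ⟨P, hP, hdom⟩ := h.settled x hx y hxy hp' R hR
        obtain ⟨P', hP', hdom'⟩ := hN.dominating P (.inl hP)
        exact ⟨P', hP', hdom'.trans hdom⟩
    · rw [Function.update_of_ne hy]
      exact h.settled x hx y hxy (fun hp' => hp ⟨hp'.1, hp'.2, hy⟩) R hR

end SearchInv

theorem inv_initial : H.Inv a b t₀ (H.initial b) := by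
  refine ⟨rfl, ?_⟩
  rintro S' rfl hS'
  simp at hS'

theorem Inv.step {x y : Config B Z} (hx : H.Inv a b t₀ x) (h : H.Step a b t₀ x y) :
    H.Inv a b t₀ y := by
  cases h with
  | @visit S' queue new visited _ hnew =>
    refine ⟨.inl hx.1, ?_⟩
    intro S hS hq S₁ hd
    by_cases hv : S₁ ∈ visited
    · exact .inl hv
    rcases hS with hS | hS
    · by_cases hSS : S = S'
      · subst hSS
        exact .inr ((hnew S₁).2 ⟨hv, hd⟩)
      · refine .inl (hx.2 S hS (fun hmem => ?_) S₁ hd)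
        rcases List.mem_cons.1 hmem with h | h
        · exact hSS h
        · exact hq (List.mem_append_left _ h)
    · exact (hq (List.mem_append_right _ hS)).elim
  | @start visited =>
    refine SearchInv.init fun S hS => ?_
    induction hS using Relation.ReflTransGen.head_induction_on with
    | refl => exact hx.1
    | head hd _ ih => exact hx.2 _ ih (by simp) _ hd
  | found hb hmin => exact SearchInv.solvesEAP_some hx hb hmin
  | deleteMin hS _ _ => exact SearchInv.deleteMin hx hS
  | keep _ hN => exact SearchInv.keep hx hN
  | improve _ hN _ hk => exact SearchInv.improve hx hN hk
  | next =>
    have hx : H.SearchInv a b t₀ _ _ _ _ := hx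
    exact { hx with settled := fun S hS S' hSS _ => hx.settled S hS S' hSS (by simp) }
  | exhausted hQ => exact SearchInv.solvesEAP_none hx hQ

/-! ### Progress -/

theorem finite_stations (H : Hierarchy T) : Finite B := Finite.of_equiv _ H.order

theorem Inv.exists_step {x : Config B Z} (hx : H.Inv a b t₀ x) :
    (∃ y, H.Step a b t₀ x y) ∨ ∃ r, x = .done r := by
  classical
  have := H.finite_stations
  cases x with
  | backward queue visited =>
    left
    cases queue with
    | nil => exact ⟨_, .start⟩
    | cons S' queue =>
      have hf := Set.toFinite {S | S ∉ visited ∧ H.Down S S'}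
      exact ⟨_, .visit (new := hf.toFinset.toList) (Finset.nodup_toList _) (by simp [Down])⟩
  | forward corridor ac Q =>
    left
    by_cases hQ : ∀ S, Q S = none
    · exact ⟨_, .exhausted hQ⟩
    · push Not at hQ
      obtain ⟨S₀, hS₀⟩ := hQ
      obtain ⟨S, hS, hmin⟩ := Set.exists_min_image {S | Q S ≠ none} (fun S => (Q S).getD 0)
        (Set.toFinite _) ⟨S₀, hS₀⟩
      obtain ⟨t, ht⟩ := Option.ne_none_iff_exists'.1 hS
      have hmin' : ∀ S' t', Q S' = some t' → t ≤ t' := fun S' t' h => by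
        simpa [ht, h] using hmin S' (by simp [h])
      by_cases hb : S = b
      · subst hb
        exact ⟨_, .found ht hmin'⟩
      · exact ⟨_, .deleteMin hb ht hmin'⟩
  | relaxing corridor S todo ac Q =>
    left
    rcases todo.eq_empty_or_nonempty with rfl | ⟨S', hS'⟩
    · exact ⟨_, .next⟩
    have hx : H.SearchInv a b t₀ _ _ _ _ := hx
    -- By soundness all arrivals lie in the finite set `labels`, so a minimum exists.
    have hfin : (ac S' ∪ T.linkArr S (ac S) (H.edge S S')).Finite := by
      refine (T.finite_labels t₀).subset ?_
      rintro L (hL | hL)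
      · exact (hx.isLabel S' L hL).mem_labels
      · exact (Timetable.IsLabel.linkArr (hx.isLabel S) (fun P hP => H.edge_path hP) hL).mem_labels
    obtain ⟨N, hN⟩ := Timetable.exists_isMinimum (T := T) S' hfin
    by_cases hne : N = ac S'
    · rw [hne] at hN
      exact ⟨_, .keep hS' hN⟩
    · have hnonempty : N.Nonempty := by
        by_contra hemp
        rw [Set.not_nonempty_iff_eq_empty] at hemp
        subst hemp
        refine hne (Set.eq_empty_of_forall_notMem fun L hL => ?_).symm
        obtain ⟨P, hP, -⟩ := hN.dominating L (.inl hL)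
        exact hP
      obtain ⟨L, hL, hmin⟩ := Set.exists_min_image N Arrival.arr (hfin.subset hN.sub) hnonempty
      refine ⟨_, .improve (k := L.arr) hS' hN hne ⟨⟨L, hL, rfl⟩, ?_⟩⟩
      rintro _ ⟨P, hP, rfl⟩
      exact hmin P hP
  | done r => exact .inr ⟨r, rfl⟩

/-! ### Termination -/

/-- The arrival connections that are not yet dominated. -/
def undominated (T : Timetable B Z) (t₀ : ℤ) (ac : B → Set (Arrival Z)) : Set (B × Arrival Z) :=
  {x | x.2 ∈ T.labels t₀ ∧ ∀ P ∈ ac x.1, ¬ T.DominatesArr x.1 P x.2}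

open Classical in
/-- Changing the arrival connections of a station makes more of them dominated. -/
theorem SearchInv.undominated_ssubset {pending : B → B → Prop} {corridor : Set B}
    {ac : B → Set (Arrival Z)} {Q : B → Option ℤ} {S S' : B} {N : Set (Arrival Z)}
    (h : H.SearchInv a b t₀ pending corridor ac Q)
    (hN : T.IsMinimum S' (ac S') (T.linkArr S (ac S) (H.edge S S')) N) (hne : N ≠ ac S') :
    undominated T t₀ (Function.update ac S' N) ⊂ undominated T t₀ ac := by
  refine ⟨?_, fun hsub => hne ?_⟩
  · rintro ⟨x, L⟩ ⟨hL, hnd⟩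
    refine ⟨hL, fun P hP hdom => ?_⟩
    by_cases hx : x = S'
    · subst hx
      obtain ⟨P', hP', hdom'⟩ := hN.dominating P (.inl hP)
      exact hnd P' (by simpa using hP') (hdom'.trans hdom)
    · exact hnd P (by simpa [hx] using hP) hdom
  · have hsubset : N ⊆ ac S' := by
      intro L hL
      by_contra hLold
      have hmem := (h.isLabel_of_isMinimum hN L hL).mem_labels
      have hun : (S', L) ∈ undominated T t₀ ac :=
        ⟨hmem, fun P hP hdom => hN.prefer_old L hL hLold P hP hdom⟩
      exact (hsub hun).2 L (by simpa using hL) (.refl T S' L)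
    refine hsubset.antisymm fun L hL => ?_
    obtain ⟨P, hP, hdom⟩ := hN.dominating L (.inl hL)
    exact h.antichain S' P (hsubset hP) L hL hdom ▸ hP

/-- A measure that decreases in each step of the time query. -/
noncomputable def progress (T : Timetable B Z) (t₀ : ℤ) : Config B Z → ℕ ×ₗ ℕ ×ₗ ℕ ×ₗ ℕ
  | .backward queue visited => toLex (2, toLex (visitedᶜ.ncard, toLex (queue.length, 0)))
  | .forward _ ac Q =>
    toLex (1, toLex ((undominated T t₀ ac).ncard, toLex ({S | Q S ≠ none}.ncard, 0)))
  | .relaxing _ _ todo ac Q =>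
    toLex (1, toLex ((undominated T t₀ ac).ncard,
      toLex ({S | Q S ≠ none}.ncard, todo.ncard + 1)))
  | .done _ => toLex (0, toLex (0, toLex (0, 0)))

theorem Inv.progress_lt {x y : Config B Z} (hx : H.Inv a b t₀ x) (h : H.Step a b t₀ x y) :
    progress T t₀ y < progress T t₀ x := by
  have := H.finite_stations
  cases h with
  | @visit S' queue new visited _ hnew =>
    simp only [progress, Prod.Lex.toLex_lt_toLex, lt_irrefl, false_or, true_and]
    -- Either nothing is discovered and the queue gets shorter, or fewer stations remain unvisited.
    rcases new with _ | ⟨S, new⟩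
    · simp
    · left
      refine Set.ncard_lt_ncard ?_ (Set.toFinite _)
      refine ⟨Set.compl_subset_compl.2 Set.subset_union_left, fun hsub => ?_⟩
      exact hsub ((hnew S).1 (by simp)).1 (.inr (by simp))
  | start => simp [progress, Prod.Lex.toLex_lt_toLex]
  | found => simp [progress, Prod.Lex.toLex_lt_toLex]
  | @deleteMin corridor ac Q S t _ hS _ =>
    simp only [progress, Prod.Lex.toLex_lt_toLex, lt_irrefl, false_or, true_and]
    left
    refine Set.ncard_lt_ncard ⟨fun x hx => ?_, fun hsub => ?_⟩ (Set.toFinite _)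
    · by_cases hxS : x = S
      · subst hxS
        simp at hx
      · simpa [hxS] using hx
    · have := hsub (show S ∈ {S | Q S ≠ none} by simp [hS])
      simp at this
  | keep hS' _ =>
    simp only [progress, Prod.Lex.toLex_lt_toLex, lt_irrefl, false_or, true_and]
    have := Set.ncard_sdiff_singleton_lt_of_mem hS' (Set.toFinite _)
    omega
  | improve _ hN hne _ =>
    simp only [progress, Prod.Lex.toLex_lt_toLex, lt_irrefl, false_or, true_and]
    left
    refine Set.ncard_lt_ncard (SearchInv.undominated_ssubset hx hN hne) ?_
    exact (Set.finite_univ.prod (T.finite_labels t₀)).subset fun x hx => ⟨trivial, hx.1⟩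
  | next => simp [progress, Prod.Lex.toLex_lt_toLex]
  | exhausted => simp [progress, Prod.Lex.toLex_lt_toLex]

theorem Inv.acc {x : Config B Z} (hx : H.Inv a b t₀ x) :
    Acc (fun y x => H.Step a b t₀ x y) x := by
  induction hm : progress T t₀ x using WellFoundedLT.induction generalizing x with
  | ind m ih =>
    subst hm
    exact ⟨_, fun y h => ih _ (hx.progress_lt h) (hx.step h) rfl⟩

end Hierarchy

end StationGraph

/-- The time query in a station graph contraction hierarchy solves the earliest arrival problem:
every execution terminates, and one that cannot be continued has returned a solution. -/
theorem mainTheorem2 {B Z : Type*} (T : StationGraph.Timetable B Z)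
    (H : StationGraph.Hierarchy T) (a b : B) (t₀ : ℤ) :
    Acc (fun y x => H.Step a b t₀ x y) (H.initial b) ∧
    ∀ x, Relation.ReflTransGen (H.Step a b t₀) (H.initial b) x →
      (¬ ∃ y, H.Step a b t₀ x y) →
      ∃ r, x = StationGraph.Config.done r ∧ T.SolvesEAP a b t₀ r := by
  refine ⟨StationGraph.Hierarchy.inv_initial.acc, fun x hx hstuck => ?_⟩
  have hinv : H.Inv a b t₀ x := by
    clear hstuck
    induction hx with
    | refl => exact StationGraph.Hierarchy.inv_initial
    | tail _ h ih => exact ih.step h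
  obtain ⟨r, rfl⟩ := hinv.exists_step.resolve_left hstuck
  exact ⟨r, rfl, hinv⟩
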